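/- Let $k$ be a field of characteristic zero, and let $n\ge 1$, $e\ge 0$, $d,m\ge 2$ be integers with $(n,e)\neq(1,0)$. Let \[P(X,S)=S^d+f_{d-1}(X)S^{d-1}+\dots+f_0(X)\in k[X,S],\qquad Q(X,Y)=Y^m+g_{m-1}(X)Y^{m-1}+\dots+g_0(X)\in k[X,Y],\] and \[R=R_{n,e,P,Q}=k[X,Y,Z]/\langle X^nY-P(X,Q(X,Y)-X^eZ)\rangle .\] Let $x,y,z$ be the classes of $X,Y,Z$ in $R$, let $s=Q(x,y)-x^ez$, and let $\partial$ be the $k$-derivation of $R$ with \[\partial(x)=0,\qquad \partial(y)=x^e\,\frac{\partial P}{\partial S}(x,s),\qquad \partial(z)=\frac{\partial Q}{\partial Y}(x,y)\,\frac{\partial P}{\partial S}(x,s)-x^n .\] This derivation is well defined and locally nilpotent (every element is killed by a power of $\partial$). Let $\mathcal F_i=\ker\partial^{\,i+1}$ for $i\ge 0$, let $\mathcal F_{-1}=0$, and let $\mathrm{Gr}_\partial(R)=\bigoplus_{i\ge0}R_{[i]}$ with $R_{[i]}=\mathcal F_i/\mathcal F_{i-1}$ be the associated graded $k$-algebra.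 For $a\in R$, $a\ne 0$, let $\overline a$ be the class $a+\mathcal F_{i-1}\in R_{[i]}$, where $i$ is the least integer with $a\in\mathcal F_i$; let $\overline 0=0$. Then: (1) For all $i\ge 0$, $0\le j\le m-1$ and $0\le l\le d-1$, \[\mathcal F_{mdi+dj+l}=k[x]\,s^ly^jz^i+\mathcal F_{mdi+dj+l-1}.\] (2) The $k$-algebra $\mathrm{Gr}_\partial(R)$ is generated by $\overline x,\overline y,\overline z,\overline s$, these satisfy $\overline x^{\,n}\overline y=\overline s^{\,d}$ and $\overline x^{\,e}\overline z=\overline y^{\,m}$, and these are the defining relations: there is an isomorphism of $k$-algebras \[k[X,Y,Z,S]/\langle X^nY-S^d,\;X^eZ-Y^m\rangle\;\cong\;\mathrm{Gr}_\partial(R)\] that sends the classes of $X,Y,Z,S$ to $\overline x,\overline y,\overline z,\overline s$. Moreover, for all $i\ge 0$, $0\le j\le m-1$ and $0\le l\le d-1$, \[R_{[mdi+dj+l]}=k[\overline x]\,\overline s^{\,l}\,\overline y^{\,j}\,\overline z^{\,i}.\] -/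

import Mathlib

noncomputable section

namespace LND

open Polynomial in
/-- `bieval a b P` is the value `P(a, b)` of a polynomial `P = ∑ c_i(X) T^i` in `k[X][T]` at two
elements `a` (for `X`) and `b` (for `T`) of a commutative `k`-algebra. -/
abbrev bieval {k A : Type*} [CommRing k] [CommRing A] [Algebra k A] (a b : A)
    (P : Polynomial (Polynomial k)) : A :=
  aevalAeval (R := k) a b P

section Filtration

variable {k B : Type*} [Field k] [CommRing B] [Algebra k B] (D : Derivation k B B)

/-- A `k`-derivation `D` of `B` is locally nilpotent if every element is killed by a power
of `D`. -/
def IsLocallyNilpotent : Prop :=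
  ∀ a : B, ∃ r : ℕ, ((D : B →ₗ[k] B) ^ r) a = 0

/-- The member `F_i = ker D^(i+1)` of the `D`-filtration. -/
def filtration (i : ℕ) : Submodule k B :=
  LinearMap.ker ((D : B →ₗ[k] B) ^ (i + 1))

/-- The previous member `F_(i-1)` of the `D`-filtration: it is `0` for `i = 0`, and `F_i` for
`i + 1`. -/
def filtrationPred : ℕ → Submodule k B
  | 0 => ⊥
  | i + 1 => filtration D i

theorem filtrationPred_eq (i : ℕ) :
    filtrationPred D i = LinearMap.ker ((D : B →ₗ[k] B) ^ i) := by
  cases i with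
  | zero =>
    ext a
    simp [filtrationPred]
  | succ i => rfl

theorem mul_mem_ker (r : ℕ) : ∀ (p q : ℕ) (a b : B), p + q ≤ r + 1 →
    ((D : B →ₗ[k] B) ^ p) a = 0 → ((D : B →ₗ[k] B) ^ q) b = 0 →
    ((D : B →ₗ[k] B) ^ r) (a * b) = 0 := by
  induction r with
  | zero =>
    intro p q a b h ha hb
    rcases p with _ | p
    · have : a = 0 := by simpa using ha
      simp [this]
    · have : q = 0 := by omega
      subst this
      have : b = 0 := by simpa using hb
      simp [this]
  | succ r ih =>
    intro p q a b h ha hb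
    rcases p with _ | p
    · have : a = 0 := by simpa using ha
      simp [this]
    rcases q with _ | q
    · have : b = 0 := by simpa using hb
      simp [this]
    have ha' : ((D : B →ₗ[k] B) ^ p) (D a) = 0 := by
      simpa [pow_succ] using ha
    have hb' : ((D : B →ₗ[k] B) ^ q) (D b) = 0 := by
      simpa [pow_succ] using hb
    have h1 := ih (p + 1) q a (D b) (by omega) ha hb'
    have h2 := ih (q + 1) p b (D a) (by omega) hb ha'
    have : ((D : B →ₗ[k] B) ^ (r + 1)) (a * b)
        = ((D : B →ₗ[k] B) ^ r) (a * D b) + ((D : B →ₗ[k] B) ^ r) (b * D a) := by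
      rw [← map_add, pow_succ]
      simp
    rw [this, h1, h2, add_zero]

theorem mul_mem_filtration {i j : ℕ} {a b : B} (ha : a ∈ filtration D i)
    (hb : b ∈ filtration D j) : a * b ∈ filtration D (i + j) :=
  mul_mem_ker D _ (i + 1) (j + 1) a b (by omega) ha hb

theorem mul_mem_filtrationPred_left {i j : ℕ} {a b : B} (ha : a ∈ filtrationPred D i)
    (hb : b ∈ filtration D j) : a * b ∈ filtrationPred D (i + j) := by
  rw [filtrationPred_eq] at *
  exact mul_mem_ker D _ i (j + 1) a b (by omega) ha hb

theorem mul_mem_filtrationPred_right {i j : ℕ} {a b : B} (ha : a ∈ filtration D i)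
    (hb : b ∈ filtrationPred D j) : a * b ∈ filtrationPred D (i + j) := by
  rw [filtrationPred_eq] at *
  exact mul_mem_ker D _ (i + 1) j a b (by omega) ha hb

theorem algebraMap_mem_filtration (c : k) : algebraMap k B c ∈ filtration D 0 := by
  simp [filtration]

/-- The quotient `F_i / F_(i-1)`. -/
def GrPiece (i : ℕ) : Type _ :=
  filtration D i ⧸ (filtrationPred D i).submoduleOf (filtration D i)

instance (i : ℕ) : AddCommGroup (GrPiece D i) :=
  inferInstanceAs (AddCommGroup (_ ⧸ (filtrationPred D i).submoduleOf (filtration D i)))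

instance (i : ℕ) : Module k (GrPiece D i) :=
  inferInstanceAs (Module k (_ ⧸ (filtrationPred D i).submoduleOf (filtration D i)))

/-- The class `a + F_(i-1)` of an element `a` of `F_i`. -/
def GrPiece.mk (i : ℕ) : filtration D i →ₗ[k] GrPiece D i :=
  ((filtrationPred D i).submoduleOf (filtration D i)).mkQ

theorem GrPiece.mk_surjective (i : ℕ) : Function.Surjective (GrPiece.mk D i) :=
  Submodule.mkQ_surjective _

theorem GrPiece.mk_eq_iff {i : ℕ} (a b : filtration D i) :
    GrPiece.mk D i a = GrPiece.mk D i b ↔ (a : B) - b ∈ filtrationPred D i :=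
  Submodule.Quotient.eq _

/-- `(a + F_(i-1)) (b + F_(j-1)) = a b + F_(i+j-1)`. -/
def GrPiece.mul {i j : ℕ} (u : GrPiece D i) (v : GrPiece D j) : GrPiece D (i + j) :=
  Quotient.liftOn₂ u v
    (fun a b => GrPiece.mk D (i + j) ⟨(a : B) * b, mul_mem_filtration D a.2 b.2⟩)
    (by
      intro a b a' b' ha hb
      have ha' : (a : B) - a' ∈ filtrationPred D i := (GrPiece.mk_eq_iff D a a').1 (Quotient.sound ha)
      have hb' : (b : B) - b' ∈ filtrationPred D j := (GrPiece.mk_eq_iff D b b').1 (Quotient.sound hb)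
      rw [GrPiece.mk_eq_iff]
      have h1 := mul_mem_filtrationPred_left D ha' b.2
      have h2 := mul_mem_filtrationPred_right D a'.2 hb'
      have h3 := add_mem h1 h2
      have h4 : ((a : B) - a') * b + a' * ((b : B) - b') = a * b - a' * b' := by ring
      rwa [h4] at h3)

theorem GrPiece.mul_mk {i j : ℕ} (a : filtration D i) (b : filtration D j) :
    GrPiece.mul D (GrPiece.mk D i a) (GrPiece.mk D j b)
      = GrPiece.mk D (i + j) ⟨(a : B) * b, mul_mem_filtration D a.2 b.2⟩ := rfl

theorem GrPiece.gradedMonoid_ext {i j : ℕ} (h : i = j) (a : filtration D i) (b : filtration D j)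
    (hab : (a : B) = b) :
    GradedMonoid.mk (A := GrPiece D) i (GrPiece.mk D i a)
      = GradedMonoid.mk (A := GrPiece D) j (GrPiece.mk D j b) := by
  subst h
  obtain rfl : a = b := Subtype.ext hab
  rfl

instance : GradedMonoid.GMul (GrPiece D) where
  mul u v := GrPiece.mul D u v

instance : GradedMonoid.GOne (GrPiece D) where
  one := GrPiece.mk D 0 ⟨1, by simpa using algebraMap_mem_filtration D 1⟩

instance : GradedMonoid.GCommMonoid (GrPiece D) where
  one_mul u := by
    obtain ⟨i, u⟩ := u
    obtain ⟨a, rfl⟩ := GrPiece.mk_surjective D _ u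
    exact GrPiece.gradedMonoid_ext D (zero_add i) _ _ (one_mul (a : B))
  mul_one u := by
    obtain ⟨i, u⟩ := u
    obtain ⟨a, rfl⟩ := GrPiece.mk_surjective D _ u
    exact GrPiece.gradedMonoid_ext D (add_zero i) _ _ (mul_one (a : B))
  mul_assoc u v w := by
    obtain ⟨i, u⟩ := u
    obtain ⟨j, v⟩ := v
    obtain ⟨l, w⟩ := w
    obtain ⟨a, rfl⟩ := GrPiece.mk_surjective D _ u
    obtain ⟨b, rfl⟩ := GrPiece.mk_surjective D _ v
    obtain ⟨c, rfl⟩ := GrPiece.mk_surjective D _ w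
    exact GrPiece.gradedMonoid_ext D (add_assoc i j l) _ _ (mul_assoc (a : B) b c)
  mul_comm u v := by
    obtain ⟨i, u⟩ := u
    obtain ⟨j, v⟩ := v
    obtain ⟨a, rfl⟩ := GrPiece.mk_surjective D _ u
    obtain ⟨b, rfl⟩ := GrPiece.mk_surjective D _ v
    exact GrPiece.gradedMonoid_ext D (add_comm i j) _ _ (mul_comm (a : B) b)

instance : DirectSum.GCommRing (GrPiece D) where
  mul_zero u := by
    obtain ⟨a, rfl⟩ := GrPiece.mk_surjective D _ u
    rw [← map_zero (GrPiece.mk D _), ← map_zero (GrPiece.mk D _)]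
    refine (GrPiece.mk_eq_iff D _ _).2 ?_
    simp
  zero_mul u := by
    obtain ⟨a, rfl⟩ := GrPiece.mk_surjective D _ u
    rw [← map_zero (GrPiece.mk D _), ← map_zero (GrPiece.mk D _)]
    refine (GrPiece.mk_eq_iff D _ _).2 ?_
    simp
  mul_add u v w := by
    obtain ⟨a, rfl⟩ := GrPiece.mk_surjective D _ u
    obtain ⟨b, rfl⟩ := GrPiece.mk_surjective D _ v
    obtain ⟨c, rfl⟩ := GrPiece.mk_surjective D _ w
    simp only [← map_add]
    change GrPiece.mk D _ _ = GrPiece.mk D _ _ + GrPiece.mk D _ _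
    rw [← map_add, GrPiece.mk_eq_iff]
    simp [mul_add]
  add_mul u v w := by
    obtain ⟨a, rfl⟩ := GrPiece.mk_surjective D _ u
    obtain ⟨b, rfl⟩ := GrPiece.mk_surjective D _ v
    obtain ⟨c, rfl⟩ := GrPiece.mk_surjective D _ w
    simp only [← map_add]
    change GrPiece.mk D _ _ = GrPiece.mk D _ _ + GrPiece.mk D _ _
    rw [← map_add, GrPiece.mk_eq_iff]
    simp [add_mul]
  natCast r := GrPiece.mk D 0 ⟨r, by simpa using algebraMap_mem_filtration D (r : k)⟩
  natCast_zero := by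
    rw [← map_zero (GrPiece.mk D _), GrPiece.mk_eq_iff]
    simp
  natCast_succ r := by
    change _ = GrPiece.mk D 0 _ + GrPiece.mk D 0 _
    rw [← map_add, GrPiece.mk_eq_iff]
    simp
  intCast r := GrPiece.mk D 0 ⟨r, by simpa using algebraMap_mem_filtration D (r : k)⟩
  intCast_ofNat r := by
    rw [GrPiece.mk_eq_iff]
    simp
  intCast_negSucc_ofNat r := by
    rw [← map_neg, GrPiece.mk_eq_iff]
    simp

instance : DirectSum.GAlgebra k (GrPiece D) where
  toFun :=
    { toFun := fun c => GrPiece.mk D 0 ⟨algebraMap k B c, algebraMap_mem_filtration D c⟩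
      map_zero' := by
        rw [← map_zero (GrPiece.mk D _), GrPiece.mk_eq_iff]
        simp
      map_add' := fun c c' => by
        rw [← map_add, GrPiece.mk_eq_iff]
        simp }
  map_one := by
    change GrPiece.mk D 0 _ = GrPiece.mk D 0 _
    rw [GrPiece.mk_eq_iff]
    simp
  map_mul c c' :=
    GrPiece.gradedMonoid_ext D (zero_add 0).symm _ _ (map_mul (algebraMap k B) c c')
  commutes c u := by
    obtain ⟨i, u⟩ := u
    obtain ⟨a, rfl⟩ := GrPiece.mk_surjective D _ u
    exact GrPiece.gradedMonoid_ext D (add_comm 0 i) _ _ (mul_comm (algebraMap k B c) (a : B))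
  smul_def c u := by
    obtain ⟨i, u⟩ := u
    obtain ⟨a, rfl⟩ := GrPiece.mk_surjective D _ u
    exact GrPiece.gradedMonoid_ext D (zero_add i).symm (c • a) _ (Algebra.smul_def c (a : B))

/-- The associated graded `k`-algebra `⨁ i, F_i / F_(i-1)` of the `D`-filtration. -/
abbrev Gr : Type _ := DirectSum ℕ (GrPiece D)

/-- The homogeneous piece `F_i / F_(i-1)` as a subspace of the associated graded algebra. -/
def homogeneousPiece (i : ℕ) : Submodule k (Gr D) :=
  LinearMap.range (DirectSum.lof k ℕ (GrPiece D) i)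

/-- The `D`-degree `min {i | D^(i+1) a = 0}` (with the harmless value `0` for `a = 0`). -/
def deg (a : B) : ℕ := sInf {i | a ∈ filtration D i}

theorem mem_filtration_deg (h : IsLocallyNilpotent D) (a : B) : a ∈ filtration D (deg D a) := by
  refine Nat.sInf_mem (s := {i | a ∈ filtration D i}) ?_
  obtain ⟨r, hr⟩ := h a
  exact ⟨r, by simp [filtration, pow_succ', hr]⟩

/-- The map `gr : B → Gr`, `a ↦ a + F_(i-1)` in `F_i / F_(i-1)`, where `i = deg a`; it sends
`0` to `0`. -/
def gr (h : IsLocallyNilpotent D) (a : B) : Gr D :=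
  DirectSum.of (GrPiece D) (deg D a) (GrPiece.mk D (deg D a) ⟨a, mem_filtration_deg D h a⟩)

end Filtration

/-- The subspace `k[x] a = {g a | g ∈ k[x]}` of a commutative `k`-algebra, where `k[x]` is the
subalgebra generated by `x`. -/
def polyMul (k : Type*) {A : Type*} [Field k] [CommRing A] [Algebra k A] (x a : A) :
    Submodule k A :=
  (Subalgebra.toSubmodule (Algebra.adjoin k {x})).map (LinearMap.mulRight k a)

section Ring

open MvPolynomial

variable {k : Type*} [Field k] (n e : ℕ) (P Q : Polynomial (Polynomial k))

/-- The polynomial `S = Q(X, Y) - X^e Z` of `k[X, Y, Z]`; the variables `X, Y, Z` are numbered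
`0, 1, 2`. -/
def sPoly : MvPolynomial (Fin 3) k :=
  bieval (X 0) (X 1) Q - X 0 ^ e * X 2

/-- The polynomial `X^n Y - P(X, Q(X, Y) - X^e Z)`. -/
def relation : MvPolynomial (Fin 3) k :=
  X 0 ^ n * X 1 - bieval (X 0) (sPoly e Q) P

/-- The ring `k[X, Y, Z] / ⟨X^n Y - P(X, Q(X, Y) - X^e Z)⟩`. -/
abbrev R : Type _ :=
  MvPolynomial (Fin 3) k ⧸ Ideal.span {relation n e P Q}

/-- The projection from `k[X, Y, Z]`. -/
def proj : MvPolynomial (Fin 3) k →ₐ[k] R n e P Q :=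
  Ideal.Quotient.mkₐ k _

/-- The derivation `X^e P_S(X, S) ∂/∂Y + (Q_Y(X, Y) P_S(X, S) - X^n) ∂/∂Z` of `k[X, Y, Z]`, where
`S = Q(X, Y) - X^e Z`. -/
def polyDer : Derivation k (MvPolynomial (Fin 3) k) (MvPolynomial (Fin 3) k) :=
  mkDerivation k ![0,
    X 0 ^ e * bieval (X 0) (sPoly e Q) (Polynomial.derivative P),
    bieval (X 0) (X 1) (Polynomial.derivative Q) *
      bieval (X 0) (sPoly e Q) (Polynomial.derivative P) - X 0 ^ n]

theorem der_bieval {A : Type*} [CommRing A] [Algebra k A] (D : Derivation k A A) (a b : A)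
    (ha : D a = 0) (F : Polynomial (Polynomial k)) :
    D (bieval a b F) = bieval a b (Polynomial.derivative F) * D b := by
  have hc : ∀ p : Polynomial k, D (Polynomial.aeval a p) = 0 := by
    intro p
    induction p using Polynomial.induction_on' with
    | add p q hp hq => simp [hp, hq]
    | monomial i c => simp [Polynomial.aeval_monomial, Derivation.leibniz_pow, ha]
  induction F using Polynomial.induction_on' with
  | add p q hp hq => simp only [bieval, map_add, add_mul] at *; rw [hp, hq]
  | monomial i c =>
    rw [Polynomial.derivative_monomial]
    simp only [bieval, ← Polynomial.C_mul_X_pow_eq_monomial, map_mul, map_pow,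
      Polynomial.aevalAeval_C, map_natCast, Polynomial.aevalAeval_Y, Derivation.leibniz, hc,
      Derivation.leibniz_pow, smul_eq_mul, nsmul_eq_mul]
    ring

theorem polyDer_X : polyDer n e P Q (X 0) = 0 := by
  simp [polyDer, mkDerivation_X]

theorem polyDer_sPoly : polyDer n e P Q (sPoly e Q) = X 0 ^ (n + e) := by
  have h0 := polyDer_X n e P Q
  rw [sPoly, map_sub, der_bieval _ _ _ h0]
  simp only [Derivation.leibniz, Derivation.leibniz_pow, h0, smul_eq_mul]
  simp [polyDer, mkDerivation_X, sPoly]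
  ring

theorem polyDer_relation : polyDer n e P Q (relation n e P Q) = 0 := by
  have h0 := polyDer_X n e P Q
  rw [relation, map_sub, der_bieval _ _ _ h0, polyDer_sPoly]
  simp only [Derivation.leibniz, Derivation.leibniz_pow, h0, smul_eq_mul]
  simp [polyDer, mkDerivation_X]
  ring

theorem polyDer_descends (f : MvPolynomial (Fin 3) k) (hf : proj n e P Q f = 0) :
    proj n e P Q (polyDer n e P Q f) = 0 := by
  have hf' : f ∈ Ideal.span {relation n e P Q} := Ideal.Quotient.eq_zero_iff_mem.1 hf
  obtain ⟨g, rfl⟩ := Ideal.mem_span_singleton'.1 hf'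
  refine Ideal.Quotient.eq_zero_iff_mem.2 (Ideal.mem_span_singleton'.2 ⟨polyDer n e P Q g, ?_⟩)
  simp [Derivation.leibniz, polyDer_relation, mul_comm]

/-- The derivation `∂` of the ring `R` induced by `polyDer`. -/
def del : Derivation k (R n e P Q) (R n e P Q) :=
  Derivation.liftOfSurjective (f := proj n e P Q)
    (Ideal.Quotient.mkₐ_surjective k _) (polyDer_descends n e P Q)

theorem del_proj (f : MvPolynomial (Fin 3) k) :
    del n e P Q (proj n e P Q f) = proj n e P Q (polyDer n e P Q f) :=
  Derivation.liftOfSurjective_apply _ (polyDer_descends n e P Q) f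

end Ring

end LND

end

/-! The ring R embeds in k(x)[S] by s ↦ S, y ↦ P(x,S)/x^n, z ↦ (Q(x,y) - S)/x^e, and there ∂ becomes
x^(n+e) d/dS. In characteristic zero F_N is therefore the set of elements of S-degree at most N. The
images of s, y, z have degrees 1, d, md, so for l < d and j < m the monomial s^l y^j z^i has degree
N = mdi + dj + l. This is a mixed-radix expansion: each N comes from exactly one such digit
monomial.

Over k[x] the digit monomials span R: P(x,s) = x^n y and Q(x,y) = x^e z + s rewrite s^d and y^m
without raising the weight a + db + mdc of s^a y^b z^c (`monomial_mem_digitSpan`). Since their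
degrees are distinct, an element of degree at most N uses only those of index at most N
(`mem_digitSpan_iff`). This gives (1), the injectivity of the embedding and local nilpotency, and
shows each R_[N] to be free of rank one over k[x].

For (2), the lower terms of P and Q, and the term s, fall into smaller filtration steps, which
leaves the two relations in Gr. The same rewriting with S^d and Y^m in place of P and Q shows that
the digit monomials span the presented ring. The map to Gr sends the one of index N to a k[x]-free
generator of the component of degree N, hence is injective (`presentationMap_injective`). -/

noncomputable section

set_option linter.unusedSectionVars false

namespace LND

/-! ### Rewriting monomials into digit monomials -/

section Spanning

variable {C A : Type*} [CommRing C] [CommRing A] [Algebra C A]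

/-- The monomial `s ^ l * y ^ j * z ^ i` whose exponents are the digits of
`N = m * d * i + d * j + l`, where `l < d` and `j < m`. -/
def digitMonomial (d m : ℕ) (y z s : A) (N : ℕ) : A :=
  s ^ (N % d) * y ^ (N / d % m) * z ^ (N / d / m)

theorem digitMonomial_eq {d m i j l : ℕ} (y z s : A) (hj : j < m) (hl : l < d) :
    digitMonomial d m y z s (m * d * i + d * j + l) = s ^ l * y ^ j * z ^ i := by
  have h : m * d * i + d * j + l = l + d * (j + m * i) := by ring
  have hd : 0 < d := by omega
  have hm : 0 < m := by omega
  rw [digitMonomial, h, Nat.add_mul_mod_self_left, Nat.mod_eq_of_lt hl,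
    Nat.add_mul_div_left _ _ hd, Nat.div_eq_of_lt hl, zero_add, Nat.add_mul_mod_self_left,
    Nat.mod_eq_of_lt hj, Nat.add_mul_div_left _ _ hm, Nat.div_eq_of_lt hj, zero_add]

theorem digits_eq {d m : ℕ} (N : ℕ) :
    m * d * (N / d / m) + d * (N / d % m) + N % d = N := by
  have h1 := Nat.div_add_mod N d
  have h2 := Nat.div_add_mod (N / d) m
  calc m * d * (N / d / m) + d * (N / d % m) + N % d
      = d * (m * (N / d / m) + N / d % m) + N % d := by ring
    _ = N := by rw [h2, h1]

variable (C) in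
/-- The span of the digit monomials of index at most `N`. -/
def digitSpan (d m : ℕ) (y z s : A) (N : ℕ) : Submodule C A :=
  Submodule.span C (digitMonomial d m y z s '' Set.Iic N)

theorem digitSpan_mono {d m : ℕ} {y z s : A} {M N : ℕ} (h : M ≤ N) :
    digitSpan C d m y z s M ≤ digitSpan C d m y z s N :=
  Submodule.span_mono (Set.image_mono (Set.Iic_subset_Iic.2 h))

theorem digitMonomial_mem_digitSpan {d m : ℕ} {y z s : A} {M N : ℕ} (h : M ≤ N) :
    digitMonomial d m y z s M ∈ digitSpan C d m y z s N :=
  Submodule.subset_span ⟨M, h, rfl⟩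

theorem mem_digitSpan_zero {d m : ℕ} {y z s a : A} :
    a ∈ digitSpan C d m y z s 0 ↔ ∃ c : C, a = c • (1 : A) := by
  have : (Set.Iic 0 : Set ℕ) = {0} := by ext; simp
  rw [digitSpan, this, Set.image_singleton, Submodule.mem_span_singleton]
  simp [digitMonomial, eq_comm]

theorem mem_digitSpan_succ {d m : ℕ} {y z s a : A} {N : ℕ} :
    a ∈ digitSpan C d m y z s (N + 1) ↔ ∃ c : C, ∃ b ∈ digitSpan C d m y z s N,
      a = c • digitMonomial d m y z s (N + 1) + b := by
  have : (Set.Iic (N + 1) : Set ℕ) = insert (N + 1) (Set.Iic N) := by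
    ext i
    simp only [Set.mem_Iic, Set.mem_insert_iff]
    omega
  rw [digitSpan, this, Set.image_insert_eq, Submodule.mem_span_insert]
  rfl

theorem _root_.Polynomial.Monic.pow_natDegree_eq {p : Polynomial C} (hp : p.Monic) (a : A) :
    a ^ p.natDegree = Polynomial.aeval a p
      - ∑ i ∈ Finset.range p.natDegree, p.coeff i • a ^ i := by
  have h := congrArg (Polynomial.aeval a) hp.as_sum
  simp only [map_add, map_pow, map_sum, map_mul, Polynomial.aeval_X, Polynomial.aeval_C] at h
  rw [h]
  simp [Algebra.smul_def]

variable {d m n e : ℕ} {t r : C} {y z s : A} {P Q : Polynomial C}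

/-- Termination is by weight N, then by total exponent T: a rewriting step yields one term of the
same weight with smaller T, and the other terms have smaller weight. The scalar r serves two uses: r
= 1 gives the relation in R, and r = 0 with P = S^d, Q = Y^m gives the relations of the graded ring.
-/
theorem monomial_mem_digitSpan (hd : 2 ≤ d) (hm : 2 ≤ m)
    (hP : P.Monic) (hPd : P.natDegree = d) (hQ : Q.Monic) (hQm : Q.natDegree = m)
    (hs : Polynomial.aeval s P = t ^ n • y) (hy : Polynomial.aeval y Q = t ^ e • z + r • s)
    (N T a b c : ℕ) (hN : a + d * b + m * d * c = N) (hT : a + b + c = T) :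
    s ^ a * y ^ b * z ^ c ∈ digitSpan C d m y z s N := by
  induction N using Nat.strong_induction_on generalizing T a b c with
  | _ N ihN =>
  induction T using Nat.strong_induction_on generalizing a b c with
  | _ T ihT =>
  have lower {a' b' c' : ℕ} (h : a' + d * b' + m * d * c' < N) :
      s ^ a' * y ^ b' * z ^ c' ∈ digitSpan C d m y z s N :=
    digitSpan_mono h.le (ihN _ h _ _ _ _ rfl rfl)
  rcases le_or_gt d a with ha | ha
  -- Replacing s^d by t^n y keeps the weight and lowers the total exponent by d - 1 > 0.
  · obtain ⟨a, rfl⟩ := Nat.exists_eq_add_of_le' ha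
    have h := hP.pow_natDegree_eq s
    rw [hPd, hs] at h
    have : s ^ (a + d) * y ^ b * z ^ c = t ^ n • (s ^ a * y ^ (b + 1) * z ^ c)
        - ∑ i ∈ Finset.range d, P.coeff i • (s ^ (a + i) * y ^ b * z ^ c) := by
      simp only [pow_add, h, mul_sub, sub_mul, Finset.mul_sum, Finset.sum_mul, Algebra.smul_def]
      congr 1
      · ring
      · exact Finset.sum_congr rfl fun i _ => by ring
    rw [this]
    refine sub_mem (Submodule.smul_mem _ _ (ihT (a + (b + 1) + c) (by omega) _ _ _ ?_ rfl))
      (sum_mem fun i hi => Submodule.smul_mem _ _ (lower ?_))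
    · rw [← hN]; ring
    · have := Finset.mem_range.1 hi
      omega
  rcases le_or_gt m b with hb | hb
  -- Replacing y^m by t^e z keeps the weight and lowers the total exponent by m - 1 > 0; the term r
  -- s has weight 1, below the weight md of y^m.
  · obtain ⟨b, rfl⟩ := Nat.exists_eq_add_of_le' hb
    have h := hQ.pow_natDegree_eq y
    rw [hQm, hy] at h
    have : s ^ a * y ^ (b + m) * z ^ c = t ^ e • (s ^ a * y ^ b * z ^ (c + 1))
        + r • (s ^ (a + 1) * y ^ b * z ^ c)
        - ∑ i ∈ Finset.range m, Q.coeff i • (s ^ a * y ^ (b + i) * z ^ c) := by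
      simp only [pow_add, h, mul_sub, sub_mul, mul_add, add_mul, Finset.mul_sum, Finset.sum_mul,
        Algebra.smul_def]
      congr 1
      · ring
      · exact Finset.sum_congr rfl fun i _ => by ring
    rw [this]
    refine sub_mem (add_mem (Submodule.smul_mem _ _
      (ihT (a + b + (c + 1)) (by omega) _ _ _ ?_ rfl)) (Submodule.smul_mem _ _ (lower ?_)))
      (sum_mem fun i hi => Submodule.smul_mem _ _ (lower ?_))
    · rw [← hN]; ring
    · have : 2 * 2 ≤ d * m := Nat.mul_le_mul hd hm
      have : d * (b + m) = d * b + d * m := by ring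
      omega
    · have : d * (b + i) < d * (b + m) :=
        Nat.mul_lt_mul_of_pos_left (by have := Finset.mem_range.1 hi; omega) (by omega)
      omega
  -- Both exponents are now genuine digits, so the monomial is itself the digit monomial of index N.
  · rw [← digitMonomial_eq y z s hb ha, ← hN]
    exact digitMonomial_mem_digitSpan (by omega)

/-- The difference consists of the terms of P of degree below d in s. This becomes the first
relation in the graded algebra. -/
theorem smul_sub_pow_mem_digitSpan (hd : 2 ≤ d) (hm : 2 ≤ m)
    (hP : P.Monic) (hPd : P.natDegree = d) (hQ : Q.Monic) (hQm : Q.natDegree = m)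
    (hs : Polynomial.aeval s P = t ^ n • y) (hy : Polynomial.aeval y Q = t ^ e • z + r • s) :
    t ^ n • y - s ^ d ∈ digitSpan C d m y z s (d - 1) := by
  have h := hP.pow_natDegree_eq s
  rw [hPd, hs] at h
  rw [h, sub_sub_cancel]
  refine sum_mem fun i hi => Submodule.smul_mem _ _ ?_
  have hi := Finset.mem_range.1 hi
  refine digitSpan_mono (by omega : i ≤ d - 1) ?_
  simpa using monomial_mem_digitSpan hd hm hP hPd hQ hQm hs hy i _ i 0 0 (by ring) rfl

/-- The difference consists of the lower terms of Q in y, of weight at most d(m - 1), and of r s, of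
weight 1. This becomes the second relation in the graded algebra. -/
theorem smul_sub_pow_mem_digitSpan' (hd : 2 ≤ d) (hm : 2 ≤ m)
    (hP : P.Monic) (hPd : P.natDegree = d) (hQ : Q.Monic) (hQm : Q.natDegree = m)
    (hs : Polynomial.aeval s P = t ^ n • y) (hy : Polynomial.aeval y Q = t ^ e • z + r • s) :
    t ^ e • z - y ^ m ∈ digitSpan C d m y z s (m * d - 1) := by
  have h := hQ.pow_natDegree_eq y
  rw [hQm, hy] at h
  have hdm : 2 * 2 ≤ m * d := Nat.mul_le_mul hm hd
  rw [show t ^ e • z - y ^ m = ∑ i ∈ Finset.range m, Q.coeff i • y ^ i - r • s by rw [h]; abel]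
  refine sub_mem (sum_mem fun i hi => Submodule.smul_mem _ _ ?_) (Submodule.smul_mem _ _ ?_)
  · have hi : d * i < m * d := by
      rw [mul_comm m]
      exact Nat.mul_lt_mul_of_pos_left (Finset.mem_range.1 hi) (by omega)
    refine digitSpan_mono (by omega : d * i ≤ m * d - 1) ?_
    simpa using monomial_mem_digitSpan hd hm hP hPd hQ hQm hs hy (d * i) _ 0 i 0 (by ring) rfl
  · refine digitSpan_mono (by omega : 1 ≤ m * d - 1) ?_
    simpa using monomial_mem_digitSpan hd hm hP hPd hQ hQm hs hy 1 _ 1 0 0 (by ring) rfl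

theorem exists_mem_digitSpan (hd : 2 ≤ d) (hm : 2 ≤ m)
    (hP : P.Monic) (hPd : P.natDegree = d) (hQ : Q.Monic) (hQm : Q.natDegree = m)
    (hs : Polynomial.aeval s P = t ^ n • y) (hy : Polynomial.aeval y Q = t ^ e • z + r • s)
    (hgen : Algebra.adjoin C {y, z, s} = ⊤) (a : A) :
    ∃ N, a ∈ digitSpan C d m y z s N := by
  have ha : a ∈ Submodule.span C (Submonoid.closure ({y, z, s} : Set A) : Set A) := by
    rw [← Algebra.adjoin_eq_span, hgen]
    trivial
  induction ha using Submodule.span_induction with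
  | mem u hu =>
    have : ∃ i j l, u = s ^ i * y ^ j * z ^ l := by
      induction hu using Submonoid.closure_induction with
      | mem u hu =>
        rcases hu with rfl | rfl | rfl
        · exact ⟨0, 1, 0, by simp⟩
        · exact ⟨0, 0, 1, by simp⟩
        · exact ⟨1, 0, 0, by simp⟩
      | one => exact ⟨0, 0, 0, by simp⟩
      | mul u v _ _ hu hv =>
        obtain ⟨i, j, l, rfl⟩ := hu
        obtain ⟨i', j', l', rfl⟩ := hv
        exact ⟨i + i', j + j', l + l', by ring⟩
    obtain ⟨i, j, l, rfl⟩ := this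
    exact ⟨_, monomial_mem_digitSpan hd hm hP hPd hQ hQm hs hy _ _ i j l rfl rfl⟩
  | zero => exact ⟨0, zero_mem _⟩
  | add u v _ _ hu hv =>
    obtain ⟨M, hu⟩ := hu
    obtain ⟨N, hv⟩ := hv
    exact ⟨max M N, add_mem (digitSpan_mono (le_max_left _ _) hu)
      (digitSpan_mono (le_max_right _ _) hv)⟩
  | smul c u _ hu =>
    obtain ⟨N, hu⟩ := hu
    exact ⟨N, Submodule.smul_mem _ c hu⟩

end Spanning

/-! ### Digit spans as degree conditions in K[S] -/

section Degree

open Polynomial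

variable {C K A : Type*} [CommRing C] [Field K] [Algebra C K]
  [CommRing A] [Algebra C A] {d m : ℕ} {y z s : A} (φ : A →ₐ[C] K[X])
  (hφ : ∀ N, (φ (digitMonomial d m y z s N)).degree = N)
  (hspan : ∀ a : A, ∃ N, a ∈ digitSpan C d m y z s N)

include hφ in
theorem degree_le_of_mem_digitSpan {a : A} {N : ℕ} (ha : a ∈ digitSpan C d m y z s N) :
    (φ a).degree ≤ N := by
  induction ha using Submodule.span_induction with
  | mem u hu =>
    obtain ⟨M, hM, rfl⟩ := hu
    rw [hφ]
    exact_mod_cast hM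
  | zero => simp
  | add u v _ _ hu hv => rw [map_add]; exact (degree_add_le _ _).trans (max_le hu hv)
  | smul c u _ hu => rw [map_smul]; exact (degree_smul_le c _).trans hu

theorem degree_smul_eq [FaithfulSMul C K] {c : C} (hc : c ≠ 0) (p : K[X]) : (c • p).degree = p.degree := by
  rw [← algebraMap_smul K c p]
  exact degree_smul_of_smul_regular _ (IsSMulRegular.of_ne_zero
    ((map_ne_zero_iff _ (FaithfulSMul.algebraMap_injective C K)).2 hc))

include hφ hspan in
-- In an expansion in digit monomials the term of largest index with nonzero coefficient alone
-- determines the degree of the image, because the degrees are distinct and nonzero scalars preserve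
-- them. Terms of index above N are stripped off one at a time.
theorem mem_digitSpan_iff [FaithfulSMul C K] {a : A} {N : ℕ} :
    a ∈ digitSpan C d m y z s N ↔ (φ a).degree ≤ N := by
  refine ⟨degree_le_of_mem_digitSpan φ hφ, fun h => ?_⟩
  obtain ⟨M, hM⟩ := hspan a
  induction M with
  | zero => exact digitSpan_mono (Nat.zero_le _) hM
  | succ M ih =>
    by_cases hMN : M + 1 ≤ N
    · exact digitSpan_mono hMN hM
    obtain ⟨c, b, hb, rfl⟩ := mem_digitSpan_succ.1 hM
    have hb' := degree_le_of_mem_digitSpan φ hφ hb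
    by_cases hc : c = 0
    · exact ih (by simpa [hc] using hb)
    exfalso
    have h1 : (c • φ (digitMonomial d m y z s (M + 1))).degree = (M + 1 : ℕ) := by
      rw [degree_smul_eq hc, hφ]
    have h2 : (φ b).degree < (M + 1 : ℕ) := hb'.trans_lt (by exact_mod_cast M.lt_succ_self)
    rw [map_add, map_smul, degree_add_eq_left_of_degree_lt (h1 ▸ h2), h1] at h
    exact hMN (by exact_mod_cast h)

include hφ hspan in
-- An element with image 0 has degree ⊥ ≤ 0, so it is a scalar c • 1; a nonzero c would give degree
-- 0 rather than ⊥.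
theorem injective_of_degree_digitMonomial [FaithfulSMul C K] : Function.Injective φ := by
  refine (injective_iff_map_eq_zero φ).2 fun a ha => ?_
  have : a ∈ digitSpan C d m y z s 0 := (mem_digitSpan_iff φ hφ hspan).2 (by simp [ha])
  obtain ⟨c, rfl⟩ := mem_digitSpan_zero.1 this
  by_cases hc : c = 0
  · simp [hc]
  · have := congrArg degree ha
    rw [map_smul, degree_smul_eq hc] at this
    simp at this

end Degree

/-! ### Evaluation of two-variable polynomials -/

section Bieval

open Polynomial

variable {k A B : Type*} [Field k] [CommRing A] [Algebra k A] [CommRing B] [Algebra k B]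

theorem bieval_eq_eval₂ (a b : A) (F : k[X][X]) :
    bieval a b F = F.eval₂ (aeval a : k[X] →ₐ[k] A).toRingHom b := by
  induction F using Polynomial.induction_on' with
  | add p q hp hq => simp only [bieval, map_add, eval₂_add] at *; rw [hp, hq]
  | monomial i c => simp [bieval, ← C_mul_X_pow_eq_monomial]

theorem map_bieval (f : A →ₐ[k] B) (a b : A) (F : k[X][X]) :
    f (bieval a b F) = bieval (f a) (f b) F := by
  induction F using Polynomial.induction_on' with
  | add p q hp hq => simp only [bieval, map_add] at *; rw [hp, hq]
  | monomial i c => simp [bieval, ← C_mul_X_pow_eq_monomial, aeval_algHom_apply]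

variable {K : Type*} [Field K] [Algebra k K] [Algebra k[X] K] [IsScalarTower k k[X] K]

theorem bieval_C (b : K[X]) (F : k[X][X]) :
    bieval (k := k) (C (algebraMap k[X] K X)) b F = (F.map (algebraMap k[X] K)).comp b := by
  rw [bieval_eq_eval₂, comp, eval₂_map]
  congr 1
  refine Polynomial.ringHom_ext (fun c => ?_) ?_
  · have h : (algebraMap k[X] K) (C c) = algebraMap k K c := by
      rw [IsScalarTower.algebraMap_apply k k[X] K]; rfl
    simp [h, IsScalarTower.algebraMap_apply k K K[X]]
  · simp

end Bieval

/-! ### The embedding of R into K[S] and the form of ∂ there -/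

section Embedding

open Polynomial

variable {k : Type*} [Field k] (n e : ℕ) (P Q : k[X][X])
variable (K : Type*) [Field K] [Algebra k K] [Algebra k[X] K] [IsScalarTower k k[X] K]

/-- The polynomial `P(x, S) / x ^ n` in `K[S]`, the image of `y` in `k(x)[S]`. -/
def yImage : K[X] :=
  C ((algebraMap k[X] K X ^ n)⁻¹) * P.map (algebraMap k[X] K)

/-- The polynomial `(Q(x, y) - S) / x ^ e` in `K[S]` with `y = P(x, S) / x ^ n`, the image of `z`
in `k(x)[S]`. -/
def zImage : K[X] :=
  C ((algebraMap k[X] K X ^ e)⁻¹) * ((Q.map (algebraMap k[X] K)).comp (yImage n P K) - X)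

/-- The map `k[X, Y, Z] → K[S]` that induces the embedding of `R` into `k(x)[S]`. -/
def polyEmbedding : MvPolynomial (Fin 3) k →ₐ[k] K[X] :=
  MvPolynomial.aeval ![C (algebraMap k[X] K X), yImage n P K, zImage n e P Q K]

theorem polyDer_X_one : polyDer n e P Q (MvPolynomial.X 1)
    = MvPolynomial.X 0 ^ e * bieval (MvPolynomial.X 0) (sPoly e Q) (derivative P) :=
  MvPolynomial.mkDerivation_X _ _ _

theorem polyDer_X_two : polyDer n e P Q (MvPolynomial.X 2)
    = bieval (MvPolynomial.X 0) (MvPolynomial.X 1) (derivative Q)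
      * bieval (MvPolynomial.X 0) (sPoly e Q) (derivative P) - MvPolynomial.X 0 ^ n :=
  MvPolynomial.mkDerivation_X _ _ _

/-- The scalars of the digit spans in R: X acts as multiplication by x. -/
instance : Algebra k[X] (R n e P Q) :=
  (aeval (proj n e P Q (MvPolynomial.X 0))).toRingHom.toAlgebra

theorem algebraMap_R_apply (p : k[X]) :
    algebraMap k[X] (R n e P Q) p = aeval (proj n e P Q (MvPolynomial.X 0)) p := rfl

theorem polyEmbedding_X_zero :
    polyEmbedding n e P Q K (MvPolynomial.X 0) = C (algebraMap k[X] K X) :=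
  MvPolynomial.aeval_X _ _

theorem polyEmbedding_X_one : polyEmbedding n e P Q K (MvPolynomial.X 1) = yImage n P K :=
  MvPolynomial.aeval_X _ _

theorem polyEmbedding_X_two : polyEmbedding n e P Q K (MvPolynomial.X 2) = zImage n e P Q K :=
  MvPolynomial.aeval_X _ _

theorem polyEmbedding_bieval (b : MvPolynomial (Fin 3) k) (F : k[X][X]) :
    polyEmbedding n e P Q K (bieval (MvPolynomial.X 0) b F)
      = (F.map (algebraMap k[X] K)).comp (polyEmbedding n e P Q K b) := by
  rw [map_bieval, polyEmbedding_X_zero, bieval_C]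

variable [FaithfulSMul k[X] K]

variable (k) in
theorem algebraMap_X_ne_zero : algebraMap k[X] K X ≠ 0 :=
  (map_ne_zero_iff _ (FaithfulSMul.algebraMap_injective k[X] K)).2 X_ne_zero

theorem C_mul_yImage :
    C (algebraMap k[X] K X) ^ n * yImage n P K = P.map (algebraMap k[X] K) := by
  rw [yImage, ← mul_assoc, ← C_pow, ← C_mul,
    mul_inv_cancel₀ (pow_ne_zero _ (algebraMap_X_ne_zero k K)), C_1, one_mul]

theorem C_mul_zImage :
    C (algebraMap k[X] K X) ^ e * zImage n e P Q K
      = (Q.map (algebraMap k[X] K)).comp (yImage n P K) - X := by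
  rw [zImage, ← mul_assoc, ← C_pow, ← C_mul,
    mul_inv_cancel₀ (pow_ne_zero _ (algebraMap_X_ne_zero k K)), C_1, one_mul]

theorem polyEmbedding_sPoly : polyEmbedding n e P Q K (sPoly e Q) = X := by
  rw [sPoly, map_sub, polyEmbedding_bieval, map_mul, map_pow, polyEmbedding_X_zero,
    polyEmbedding_X_one, polyEmbedding_X_two, C_mul_zImage, sub_sub_cancel]

theorem polyEmbedding_relation : polyEmbedding n e P Q K (relation n e P Q) = 0 := by
  rw [relation, map_sub, polyEmbedding_bieval, polyEmbedding_sPoly, map_mul, map_pow,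
    polyEmbedding_X_zero, polyEmbedding_X_one, C_mul_yImage, comp_X, sub_self]

/-- The embedding of `R` into `K[S]`, where `K` is a field that contains `k[x]`. -/
def embedding : R n e P Q →ₐ[k] K[X] :=
  Ideal.Quotient.liftₐ _ (polyEmbedding n e P Q K) fun a ha => by
    obtain ⟨b, rfl⟩ := Ideal.mem_span_singleton'.1 ha
    rw [map_mul, polyEmbedding_relation, mul_zero]

theorem embedding_proj (f : MvPolynomial (Fin 3) k) :
    embedding n e P Q K (proj n e P Q f) = polyEmbedding n e P Q K f := rfl

theorem embedding_aeval (p : k[X]) :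
    embedding n e P Q K (aeval (proj n e P Q (MvPolynomial.X 0)) p)
      = C (algebraMap k[X] K p) := by
  rw [← aeval_algHom_apply, embedding_proj]
  simp only [polyEmbedding, MvPolynomial.aeval_X]
  -- A polynomial in X alone is constant in the second variable, whose value 0 is arbitrary.
  have := bieval_C (K := K) 0 (C p)
  simpa [bieval] using this

/-- The embedding of `R` into `K[S]` as a morphism of `k[x]`-algebras. -/
def embeddingₐ : R n e P Q →ₐ[k[X]] K[X] :=
  { (embedding n e P Q K).toRingHom with
    commutes' := embedding_aeval n e P Q K }

/-- Both sides are derivations along the embedding, so agreement on x, y, z suffices. -/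
theorem embedding_derivation (D : Derivation k K[X] K[X])
    (hD : ∀ p, D p = C (algebraMap k[X] K X) ^ (n + e) * derivative p) (a : R n e P Q) :
    embedding n e P Q K (del n e P Q a) = D (embedding n e P Q K a) := by
  obtain ⟨f, rfl⟩ := Ideal.Quotient.mkₐ_surjective k _ a
  change embedding n e P Q K (del n e P Q (proj n e P Q f)) = _
  rw [del_proj]
  change polyEmbedding n e P Q K _ = D (polyEmbedding n e P Q K f)
  have h0 : D (C (algebraMap k[X] K X)) = 0 := by simp [hD]
  have hC : C (algebraMap k[X] K X) ≠ 0 := C_ne_zero.2 (algebraMap_X_ne_zero k K)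
  have hY : D (yImage n P K) = C (algebraMap k[X] K X) ^ e
      * (derivative P).map (algebraMap k[X] K) := by
    rw [hD, yImage, derivative_C_mul, ← C_mul_yImage n (derivative P) K, yImage, derivative_map]
    ring
  have hZ : D (zImage n e P Q K) = ((derivative Q).map (algebraMap k[X] K)).comp (yImage n P K)
      * (derivative P).map (algebraMap k[X] K) - C (algebraMap k[X] K X) ^ n := by
    -- Differentiating x^e z = Q(x,y) - S avoids the denominator; x^e is a constant of D and
    -- cancels.
    refine mul_left_cancel₀ (pow_ne_zero e hC) ?_
    have h := congrArg D (C_mul_zImage n e P Q K)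
    rw [Derivation.leibniz, Derivation.leibniz_pow, h0, map_sub, ← bieval_C,
      der_bieval D _ _ h0, hY, bieval_C, hD X] at h
    simp only [smul_eq_mul, derivative_X] at h
    linear_combination h
  induction f using MvPolynomial.induction_on with
  | C c => rw [← MvPolynomial.algebraMap_eq, Derivation.map_algebraMap, AlgHom.commutes,
      Derivation.map_algebraMap, map_zero]
  | add p q hp hq => simp only [map_add, hp, hq]
  | mul_X p i hp =>
    rw [Derivation.leibniz, map_mul, Derivation.leibniz, map_add, smul_eq_mul, smul_eq_mul,
      map_mul, map_mul, hp, smul_eq_mul, smul_eq_mul]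
    congr 2
    fin_cases i
    · change polyEmbedding n e P Q K (polyDer n e P Q (MvPolynomial.X 0))
        = D (polyEmbedding n e P Q K (MvPolynomial.X 0))
      rw [polyDer_X, map_zero, polyEmbedding_X_zero, h0]
    · change polyEmbedding n e P Q K (polyDer n e P Q (MvPolynomial.X 1))
        = D (polyEmbedding n e P Q K (MvPolynomial.X 1))
      rw [polyDer_X_one, map_mul, map_pow, polyEmbedding_bieval, polyEmbedding_sPoly, comp_X,
        polyEmbedding_X_zero, polyEmbedding_X_one, hY]
    · change polyEmbedding n e P Q K (polyDer n e P Q (MvPolynomial.X 2))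
        = D (polyEmbedding n e P Q K (MvPolynomial.X 2))
      rw [polyDer_X_two, map_sub, map_mul, map_pow, polyEmbedding_bieval, polyEmbedding_bieval,
        polyEmbedding_sPoly, comp_X, polyEmbedding_X_zero, polyEmbedding_X_one,
        polyEmbedding_X_two, hZ]

/-- The factor x^(n+e) is constant for d/dS, so it passes through all iterates. -/
theorem embedding_del_pow (r : ℕ) (a : R n e P Q) :
    embedding n e P Q K (((del n e P Q : R n e P Q →ₗ[k] R n e P Q) ^ r) a)
      = C ((algebraMap k[X] K X ^ (n + e)) ^ r) * derivative^[r] (embedding n e P Q K a) := by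
  set D : Derivation k K[X] K[X] :=
    C (algebraMap k[X] K X ^ (n + e)) • (derivative' (R := K)).restrictScalars k with hD
  induction r with
  | zero => simp
  | succ r ih =>
    rw [pow_succ', Module.End.mul_apply]
    change embedding n e P Q K (del n e P Q _) = _
    rw [embedding_derivation n e P Q K D (fun p => by simp [D, derivative']) _, ih]
    simp only [D, Function.iterate_succ_apply', pow_succ', C_mul]
    simp [derivative']
    ring

variable {n e P Q} {d m : ℕ}

theorem degree_yImage (hP : P.Monic) (hPd : P.natDegree = d) : (yImage n P K).degree = d := by
  rw [yImage, degree_C_mul (inv_ne_zero (pow_ne_zero _ (algebraMap_X_ne_zero k K))),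
    hP.degree_map, degree_eq_natDegree hP.ne_zero, hPd]

/-- Q(x,y) has degree md ≥ 4 in S, so subtracting S does not change the degree. -/
theorem degree_zImage (hd : 2 ≤ d) (hm : 2 ≤ m) (hP : P.Monic) (hPd : P.natDegree = d)
    (hQ : Q.Monic) (hQm : Q.natDegree = m) : (zImage n e P Q K).degree = (m * d : ℕ) := by
  have hdm : 2 * 2 ≤ m * d := Nat.mul_le_mul hm hd
  have hcomp : ((Q.map (algebraMap k[X] K)).comp (yImage n P K)).natDegree = m * d := by
    rw [natDegree_comp, hQ.natDegree_map, hQm,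
      natDegree_eq_of_degree_eq_some (degree_yImage K hP hPd)]
  have hcomp' : ((Q.map (algebraMap k[X] K)).comp (yImage n P K)).degree = (m * d : ℕ) := by
    rw [degree_eq_iff_natDegree_eq_of_pos (by omega), hcomp]
  rw [zImage, degree_C_mul (inv_ne_zero (pow_ne_zero _ (algebraMap_X_ne_zero k K))),
    degree_sub_eq_left_of_degree_lt, hcomp']
  rw [hcomp', degree_X]
  exact_mod_cast (by omega : 1 < m * d)

end Embedding

/-! ### The filtration of R by S-degree -/

section RingSpan

open Polynomial

variable {k : Type*} [Field k] {n e d m : ℕ} {P Q : k[X][X]}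

local notation "K" => FractionRing k[X]
local notation "xR" => proj n e P Q (MvPolynomial.X 0)
local notation "yR" => proj n e P Q (MvPolynomial.X 1)
local notation "zR" => proj n e P Q (MvPolynomial.X 2)
local notation "sR" => proj n e P Q (sPoly e Q)

theorem proj_sPoly : sR = bieval xR yR Q - xR ^ e * zR := by
  rw [sPoly, map_sub, map_bieval, map_mul, map_pow]

theorem bieval_eq_aeval (b : R n e P Q) (F : k[X][X]) : bieval xR b F = aeval b F :=
  bieval_eq_eval₂ _ _ _

theorem X_pow_smul (i : ℕ) (a : R n e P Q) : (X : k[X]) ^ i • a = xR ^ i * a := by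
  rw [Algebra.smul_def, algebraMap_R_apply, map_pow, aeval_X]

theorem aeval_sPoly : aeval sR P = (X : k[X]) ^ n • yR := by
  have h : proj n e P Q (MvPolynomial.X 0 ^ n * MvPolynomial.X 1
      - bieval (MvPolynomial.X 0) (sPoly e Q) P) = 0 :=
    Ideal.Quotient.eq_zero_iff_mem.2 (Ideal.mem_span_singleton_self (relation n e P Q))
  rw [map_sub, map_bieval, map_mul, map_pow, sub_eq_zero] at h
  rw [X_pow_smul, h, bieval_eq_aeval]

theorem aeval_y : aeval yR Q = (X : k[X]) ^ e • zR + (1 : k[X]) • sR := by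
  rw [proj_sPoly, X_pow_smul, bieval_eq_aeval, one_smul, add_sub_cancel]

theorem adjoin_R : Algebra.adjoin k[X] {yR, zR, sR} = ⊤ := by
  rw [eq_top_iff]
  rintro a -
  obtain ⟨f, rfl⟩ := Ideal.Quotient.mkₐ_surjective k _ a
  change proj n e P Q f ∈ _
  induction f using MvPolynomial.induction_on with
  | C c =>
    have : proj n e P Q (MvPolynomial.C c) = algebraMap k[X] (R n e P Q) (C c) := by
      rw [algebraMap_R_apply, aeval_C, ← MvPolynomial.algebraMap_eq, AlgHom.commutes]
    rw [this]
    exact Subalgebra.algebraMap_mem _ _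
  | add p q hp hq => rw [map_add]; exact add_mem hp hq
  | mul_X p i hp =>
    rw [map_mul]
    refine mul_mem hp ?_
    fin_cases i
    · have : xR = algebraMap k[X] (R n e P Q) X := by rw [algebraMap_R_apply, aeval_X]
      exact this ▸ Subalgebra.algebraMap_mem _ _
    · exact Algebra.subset_adjoin (by simp)
    · exact Algebra.subset_adjoin (by simp)

theorem degree_embedding_digitMonomial (hd : 2 ≤ d) (hm : 2 ≤ m)
    (hP : P.Monic) (hPd : P.natDegree = d) (hQ : Q.Monic) (hQm : Q.natDegree = m) (N : ℕ) :
    (embeddingₐ n e P Q K (digitMonomial d m yR zR sR N)).degree = N := by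
  have h1 : embeddingₐ n e P Q K yR = yImage n P K := polyEmbedding_X_one n e P Q K
  have h2 : embeddingₐ n e P Q K zR = zImage n e P Q K := polyEmbedding_X_two n e P Q K
  have h3 : embeddingₐ n e P Q K sR = X := polyEmbedding_sPoly n e P Q K
  rw [digitMonomial, map_mul, map_mul, map_pow, map_pow, map_pow, h1, h2, h3, degree_mul,
    degree_mul, degree_pow, degree_pow, degree_pow, degree_yImage K hP hPd,
    degree_zImage K hd hm hP hPd hQ hQm, degree_X]
  conv_rhs => rw [← digits_eq (d := d) (m := m) N]
  simp only [nsmul_eq_mul]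
  norm_cast
  ring

theorem exists_mem_digitSpan_R (hd : 2 ≤ d) (hm : 2 ≤ m)
    (hP : P.Monic) (hPd : P.natDegree = d) (hQ : Q.Monic) (hQm : Q.natDegree = m)
    (a : R n e P Q) : ∃ N, a ∈ digitSpan k[X] d m yR zR sR N :=
  exists_mem_digitSpan hd hm hP hPd hQ hQm aeval_sPoly aeval_y adjoin_R a

variable [CharZero k]

/-- Up to a nonzero constant, the r-th power of ∂ is the r-th derivative, which in characteristic
zero kills exactly the polynomials of degree below r. -/
theorem ker_del_pow (hd : 2 ≤ d) (hm : 2 ≤ m)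
    (hP : P.Monic) (hPd : P.natDegree = d) (hQ : Q.Monic) (hQm : Q.natDegree = m)
    (a : R n e P Q) (r : ℕ) :
    ((del n e P Q : R n e P Q →ₗ[k] R n e P Q) ^ r) a = 0
      ↔ (embeddingₐ n e P Q K a).degree < r := by
  have : CharZero K := charZero_of_injective_algebraMap (algebraMap k K).injective
  have hinj := injective_of_degree_digitMonomial _
    (degree_embedding_digitMonomial (n := n) (e := e) hd hm hP hPd hQ hQm)
    (exists_mem_digitSpan_R hd hm hP hPd hQ hQm)
  rw [← map_eq_zero_iff _ hinj]
  change embedding n e P Q K _ = 0 ↔ (embedding n e P Q K a).degree < r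
  rw [embedding_del_pow, mul_eq_zero, or_iff_right (C_ne_zero.2 (pow_ne_zero _
    (pow_ne_zero _ (algebraMap_X_ne_zero k K))))]
  refine ⟨fun h => ?_, fun h => ?_⟩
  · by_contra hr
    have h0 : embedding n e P Q K a ≠ 0 := by
      rintro h0
      simp [h0] at hr
    have hr' : r ≤ (embedding n e P Q K a).natDegree := by
      rw [degree_eq_natDegree h0, not_lt] at hr
      exact_mod_cast hr
    obtain ⟨j, hj⟩ := Nat.exists_eq_add_of_le' hr'
    -- At j = deg - r the coefficient of the r-th derivative is the leading coefficient times the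
    -- descending factorial of deg of length r, which is nonzero as r ≤ deg.
    have := congrArg (coeff · j) h
    simp only [coeff_iterate_derivative, coeff_zero, ← hj, coeff_natDegree, smul_eq_zero,
      leadingCoeff_eq_zero, h0, or_false] at this
    rw [Nat.descFactorial_eq_zero_iff_lt] at this
    omega
  · by_cases h0 : embedding n e P Q K a = 0
    · simp [h0]
    · exact iterate_derivative_eq_zero ((natDegree_lt_iff_degree_lt h0).2 h)

theorem mem_filtration_iff (hd : 2 ≤ d) (hm : 2 ≤ m)
    (hP : P.Monic) (hPd : P.natDegree = d) (hQ : Q.Monic) (hQm : Q.natDegree = m)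
    (N : ℕ) (a : R n e P Q) :
    a ∈ filtration (del n e P Q) N ↔ a ∈ digitSpan k[X] d m yR zR sR N := by
  rw [mem_digitSpan_iff _ (degree_embedding_digitMonomial hd hm hP hPd hQ hQm)
    (exists_mem_digitSpan_R hd hm hP hPd hQ hQm), filtration, LinearMap.mem_ker,
    ker_del_pow hd hm hP hPd hQ hQm]
  -- What remains is i < N + 1 ↔ i ≤ N in `WithBot ℕ`; the value ⊥ is the degree of the zero
  -- element.
  generalize (embeddingₐ n e P Q K a).degree = i
  cases i with
  | bot => simp
  | coe i => exact WithBot.coe_lt_coe.trans (Nat.lt_succ_iff.trans WithBot.coe_le_coe.symm)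

/-- This is the freeness over k[x] of the piece of degree N: a nonzero multiple of the digit
monomial still has degree exactly N. -/
theorem eq_zero_of_smul_mem_filtrationPred (hd : 2 ≤ d) (hm : 2 ≤ m)
    (hP : P.Monic) (hPd : P.natDegree = d) (hQ : Q.Monic) (hQm : Q.natDegree = m)
    (N : ℕ) (c : k[X])
    (h : c • digitMonomial d m yR zR sR N ∈ filtrationPred (del n e P Q) N) : c = 0 := by
  by_contra hc
  rw [filtrationPred_eq, LinearMap.mem_ker, ker_del_pow hd hm hP hPd hQ hQm, map_smul,
    degree_smul_eq hc, degree_embedding_digitMonomial hd hm hP hPd hQ hQm] at h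
  exact lt_irrefl _ h

end RingSpan

/-! ### Elements of k[x] a -/

section PolyMul

open Polynomial

variable {k A : Type*} [Field k] [CommRing A] [Algebra k A]

theorem mem_polyMul {x a u : A} : u ∈ polyMul k x a ↔ ∃ p : k[X], aeval x p * a = u := by
  simp [polyMul, Algebra.adjoin_singleton_eq_range_aeval]

end PolyMul

/-! ### Calculus of classes in the associated graded algebra -/

section Classes

variable {k B : Type*} [Field k] [CommRing B] [Algebra k B] (D : Derivation k B B)

/-- The class `a + F_(i-1)` of an element `a` of `F_i` in the associated graded algebra. -/
def cls (i : ℕ) (a : B) (ha : a ∈ filtration D i) : Gr D :=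
  DirectSum.of (GrPiece D) i (GrPiece.mk D i ⟨a, ha⟩)

variable {D}

/-- The degree occurs in the type of the membership proof, so changes of degree and of
representative are made together here. -/
theorem cls_congr {i j : ℕ} {a b : B} (hij : i = j) (hab : a = b) (ha : a ∈ filtration D i) :
    cls D i a ha = cls D j b (hij ▸ hab ▸ ha) := by
  subst hij hab
  rfl

theorem cls_eq_iff {i : ℕ} {a b : B} {ha : a ∈ filtration D i} {hb : b ∈ filtration D i} :
    cls D i a ha = cls D i b hb ↔ a - b ∈ filtrationPred D i := by
  rw [cls, cls, (DirectSum.of_injective i).eq_iff, GrPiece.mk_eq_iff]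

theorem cls_add {i : ℕ} {a b : B} (ha : a ∈ filtration D i) (hb : b ∈ filtration D i) :
    cls D i a ha + cls D i b hb = cls D i (a + b) (add_mem ha hb) := by
  rw [cls, cls, ← map_add, ← map_add]
  rfl

theorem cls_mul {i j : ℕ} {a b : B} (ha : a ∈ filtration D i) (hb : b ∈ filtration D j) :
    cls D i a ha * cls D j b hb = cls D (i + j) (a * b) (mul_mem_filtration D ha hb) :=
  DirectSum.of_mul_of _ _

theorem algebraMap_Gr (c : k) :
    algebraMap k (Gr D) c = cls D 0 (algebraMap k B c) (algebraMap_mem_filtration D c) := rfl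

theorem pow_mem_filtration {i : ℕ} {a : B} (ha : a ∈ filtration D i) (r : ℕ) :
    a ^ r ∈ filtration D (r * i) := by
  induction r with
  | zero => simpa using algebraMap_mem_filtration D 1
  | succ r ih =>
    rw [pow_succ, Nat.succ_mul]
    exact mul_mem_filtration D ih ha

theorem cls_pow {i : ℕ} {a : B} (ha : a ∈ filtration D i) (r : ℕ) :
    cls D i a ha ^ r = cls D (r * i) (a ^ r) (pow_mem_filtration ha r) := by
  induction r with
  | zero =>
    rw [pow_zero, ← map_one (algebraMap k (Gr D)), algebraMap_Gr]
    exact cls_congr (zero_mul i).symm (by simp) _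
  | succ r ih =>
    rw [pow_succ, ih, cls_mul]
    exact cls_congr (by ring) (pow_succ a r).symm _

theorem cls_apply_of_ne {i j : ℕ} {a : B} {ha : a ∈ filtration D i} (h : i ≠ j) :
    cls D i a ha j = 0 :=
  DirectSum.of_eq_of_ne _ _ _ h.symm

theorem mem_filtrationPred_of_cls_apply {i : ℕ} {a : B} {ha : a ∈ filtration D i}
    (h : cls D i a ha i = 0) : a ∈ filtrationPred D i := by
  rw [cls, DirectSum.of_eq_same, ← map_zero (GrPiece.mk D i), GrPiece.mk_eq_iff] at h
  simpa using h

theorem mem_homogeneousPiece {i : ℕ} {u : Gr D} :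
    u ∈ homogeneousPiece D i ↔ ∃ a ha, cls D i a ha = u := by
  constructor
  · rintro ⟨v, rfl⟩
    obtain ⟨⟨a, ha⟩, rfl⟩ := GrPiece.mk_surjective D i v
    exact ⟨a, ha, rfl⟩
  · rintro ⟨a, ha, rfl⟩
    exact ⟨_, rfl⟩

theorem aeval_cls_zero {x : B} (hx : x ∈ filtration D 0) (p : Polynomial k) :
    ∃ h, Polynomial.aeval (cls D 0 x hx) p = cls D 0 (Polynomial.aeval x p) h := by
  induction p using Polynomial.induction_on' with
  | add p q hp hq =>
    obtain ⟨h1, h1'⟩ := hp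
    obtain ⟨h2, h2'⟩ := hq
    have h := add_mem h1 h2
    rw [← map_add] at h
    refine ⟨h, ?_⟩
    rw [map_add, h1', h2', cls_add]
    exact cls_congr rfl (map_add _ _ _).symm _
  | monomial i c =>
    have h := mul_mem_filtration D (algebraMap_mem_filtration D c) (pow_mem_filtration hx i)
    rw [← Polynomial.aeval_monomial, mul_zero, zero_add] at h
    refine ⟨h, ?_⟩
    rw [Polynomial.aeval_monomial, cls_pow, algebraMap_Gr, cls_mul]
    exact cls_congr (by simp) (Polynomial.aeval_monomial x).symm _

theorem filtration_mono {i j : ℕ} (h : i ≤ j) : filtration D i ≤ filtration D j := by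
  intro a ha
  obtain ⟨r, rfl⟩ := Nat.exists_eq_add_of_le' h
  rw [filtration, LinearMap.mem_ker] at *
  rw [add_assoc, pow_add, Module.End.mul_apply, ha, map_zero]

theorem deg_eq {i : ℕ} {a : B} (ha : a ∈ filtration D i) (ha' : a ∉ filtrationPred D i) :
    deg D a = i := by
  have hle : deg D a ≤ i := Nat.sInf_le ha
  have hmem : a ∈ filtration D (deg D a) := Nat.sInf_mem (s := {i | a ∈ filtration D i}) ⟨i, ha⟩
  refine hle.antisymm (not_lt.1 fun hlt => ha' ?_)
  cases i with
  | zero => omega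
  | succ i => exact filtration_mono (by omega) hmem

theorem gr_eq_cls (h : IsLocallyNilpotent D) {i : ℕ} {a : B} (ha : a ∈ filtration D i)
    (hi : deg D a = i) : gr D h a = cls D i a ha := by
  subst hi
  rfl

end Classes

/-! ### Consequences of a digit basis for filtration and graded algebra -/

section DigitBasis

open Polynomial

variable {k B : Type*} [Field k] [CommRing B] [Algebra k B] [Algebra k[X] B]
  {D : Derivation k B B} {d m : ℕ} {x y z s : B}
  (hx : ∀ p : k[X], algebraMap k[X] B p = aeval x p)
  (hF : ∀ N a, a ∈ filtration D N ↔ a ∈ digitSpan k[X] d m y z s N)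
  (hind : ∀ N (c : k[X]), c • digitMonomial d m y z s N ∈ filtrationPred D N → c = 0)

include hF in
theorem mem_filtration_iff_exists {N : ℕ} {a : B} : a ∈ filtration D N ↔
    ∃ c : k[X], ∃ b ∈ filtrationPred D N, a = c • digitMonomial d m y z s N + b := by
  rw [hF]
  cases N with
  | zero =>
    rw [mem_digitSpan_zero]
    simp [filtrationPred, digitMonomial]
  | succ N =>
    rw [mem_digitSpan_succ]
    simp only [filtrationPred, hF]

include hF in
theorem smul_digitMonomial_mem_filtration (N : ℕ) (c : k[X]) :
    c • digitMonomial d m y z s N ∈ filtration D N :=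
  (mem_filtration_iff_exists hF).2 ⟨c, 0, zero_mem _, (add_zero _).symm⟩

include hF in
theorem digitMonomial_mem_filtration (N : ℕ) : digitMonomial d m y z s N ∈ filtration D N :=
  (hF _ _).2 (digitMonomial_mem_digitSpan le_rfl)

include hx hF in
theorem filtration_eq_polyMul_sup (N : ℕ) : filtration D N =
    polyMul k x (digitMonomial d m y z s N) ⊔ filtrationPred D N := by
  ext a
  rw [mem_filtration_iff_exists hF, Submodule.mem_sup]
  simp only [mem_polyMul, Algebra.smul_def, hx]
  constructor
  · rintro ⟨c, b, hb, rfl⟩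
    exact ⟨_, ⟨c, rfl⟩, b, hb, rfl⟩
  · rintro ⟨_, ⟨c, rfl⟩, b, hb, rfl⟩
    exact ⟨c, b, hb, rfl⟩

include hF hind in
theorem deg_digitMonomial (N : ℕ) : deg D (digitMonomial d m y z s N) = N :=
  deg_eq (digitMonomial_mem_filtration hF N) fun h =>
    one_ne_zero (hind N 1 (by rwa [one_smul]))

include hF hind in
theorem gr_digitMonomial (h : IsLocallyNilpotent D) (N : ℕ) :
    gr D h (digitMonomial d m y z s N)
      = cls D N (digitMonomial d m y z s N) (digitMonomial_mem_filtration hF N) :=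
  gr_eq_cls h _ (deg_digitMonomial hF hind N)

include hx hF in
theorem mem_filtration_zero : x ∈ filtration D 0 := by
  rw [hF, mem_digitSpan_zero]
  exact ⟨X, by rw [Algebra.smul_def, hx, aeval_X, mul_one]⟩

include hx hF in
theorem gr_x (h : IsLocallyNilpotent D) : gr D h x = cls D 0 x (mem_filtration_zero hx hF) :=
  gr_eq_cls h _ (Nat.le_zero.1 (Nat.sInf_le (mem_filtration_zero hx hF)))

section Generators

variable (hd : 2 ≤ d) (hm : 2 ≤ m)

include hd hm in
theorem digitMonomial_y : digitMonomial d m y z s d = y := by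
  simpa using digitMonomial_eq (d := d) (m := m) (i := 0) (j := 1) (l := 0) y z s
    (by omega) (by omega)

include hd hm in
theorem digitMonomial_z : digitMonomial d m y z s (m * d) = z := by
  simpa using digitMonomial_eq (d := d) (m := m) (i := 1) (j := 0) (l := 0) y z s
    (by omega) (by omega)

include hd hm in
theorem digitMonomial_s : digitMonomial d m y z s 1 = s := by
  simpa using digitMonomial_eq (d := d) (m := m) (i := 0) (j := 0) (l := 1) y z s
    (by omega) (by omega)

include hF hd hm in
theorem y_mem_filtration : y ∈ filtration D d := by
  simpa only [digitMonomial_y hd hm] using digitMonomial_mem_filtration hF d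

include hF hd hm in
theorem z_mem_filtration : z ∈ filtration D (m * d) := by
  simpa only [digitMonomial_z hd hm] using digitMonomial_mem_filtration hF (m * d)

include hF hd hm in
theorem s_mem_filtration : s ∈ filtration D 1 := by
  simpa only [digitMonomial_s hd hm] using digitMonomial_mem_filtration hF 1

include hF hind hd hm

theorem gr_y (h : IsLocallyNilpotent D) :
    gr D h y = cls D d y (y_mem_filtration hF hd hm) := by
  simpa only [digitMonomial_y hd hm] using gr_digitMonomial hF hind h d

theorem gr_z (h : IsLocallyNilpotent D) :
    gr D h z = cls D (m * d) z (z_mem_filtration hF hd hm) := by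
  simpa only [digitMonomial_z hd hm] using gr_digitMonomial hF hind h (m * d)

theorem gr_s (h : IsLocallyNilpotent D) :
    gr D h s = cls D 1 s (s_mem_filtration hF hd hm) := by
  simpa only [digitMonomial_s hd hm] using gr_digitMonomial hF hind h 1

theorem digitMonomial_gr (h : IsLocallyNilpotent D) (N : ℕ) :
    digitMonomial d m (gr D h y) (gr D h z) (gr D h s) N
      = cls D N (digitMonomial d m y z s N) (digitMonomial_mem_filtration hF N) := by
  rw [digitMonomial, gr_y hF hind hd hm, gr_z hF hind hd hm, gr_s hF hind hd hm, cls_pow, cls_pow,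
    cls_pow, cls_mul, cls_mul]
  refine cls_congr ?_ rfl _
  conv_rhs => rw [← digits_eq (d := d) (m := m) N]
  ring

include hx

theorem aeval_gr_mul_digitMonomial (h : IsLocallyNilpotent D) (N : ℕ) (c : k[X]) :
    aeval (gr D h x) c * digitMonomial d m (gr D h y) (gr D h z) (gr D h s) N
      = cls D N (c • digitMonomial d m y z s N) (smul_digitMonomial_mem_filtration hF N c) := by
  obtain ⟨h1, h2⟩ := aeval_cls_zero (mem_filtration_zero hx hF) c
  rw [digitMonomial_gr hF hind hd hm, gr_x hx hF, h2, cls_mul]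
  exact cls_congr (zero_add N) (by rw [Algebra.smul_def, hx]) _

/-- Modulo the previous step of the filtration, only the top term c • (digit monomial of index N) of
an element of F_N survives. -/
theorem homogeneousPiece_eq_polyMul (h : IsLocallyNilpotent D) (N : ℕ) :
    homogeneousPiece D N
      = polyMul k (gr D h x) (digitMonomial d m (gr D h y) (gr D h z) (gr D h s) N) := by
  ext u
  rw [mem_homogeneousPiece, mem_polyMul]
  constructor
  · rintro ⟨a, ha, rfl⟩
    obtain ⟨c, b, hb, rfl⟩ := (mem_filtration_iff_exists hF).1 ha
    refine ⟨c, ?_⟩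
    rw [aeval_gr_mul_digitMonomial hx hF hind hd hm, cls_eq_iff]
    simpa using hb
  · rintro ⟨c, rfl⟩
    exact ⟨_, _, (aeval_gr_mul_digitMonomial hx hF hind hd hm h N c).symm⟩

theorem adjoin_gr (h : IsLocallyNilpotent D) :
    Algebra.adjoin k {gr D h x, gr D h y, gr D h z, gr D h s} = ⊤ := by
  rw [eq_top_iff]
  rintro u -
  set S := Algebra.adjoin k {gr D h x, gr D h y, gr D h z, gr D h s} with hS
  have hxS : gr D h x ∈ S := Algebra.subset_adjoin (by simp)
  have hyS : gr D h y ∈ S := Algebra.subset_adjoin (by simp)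
  have hzS : gr D h z ∈ S := Algebra.subset_adjoin (by simp)
  have hsS : gr D h s ∈ S := Algebra.subset_adjoin (by simp)
  induction u using DirectSum.induction_on with
  | zero => exact zero_mem _
  | of i v =>
    have hv : DirectSum.of (GrPiece D) i v ∈ homogeneousPiece D i := ⟨v, rfl⟩
    rw [homogeneousPiece_eq_polyMul hx hF hind hd hm h, mem_polyMul] at hv
    obtain ⟨c, hc⟩ := hv
    rw [← hc]
    have hcS : aeval (gr D h x) c ∈ S :=
      Algebra.adjoin_mono (by simp) (aeval_mem_adjoin_singleton k _)
    exact mul_mem hcS (mul_mem (mul_mem (pow_mem hsS _) (pow_mem hyS _)) (pow_mem hzS _))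
  | add u v hu hv => exact add_mem hu hv

variable {n e : ℕ}

theorem gr_relation_y (h : IsLocallyNilpotent D)
    (hrel : (X : k[X]) ^ n • y - s ^ d ∈ digitSpan k[X] d m y z s (d - 1)) :
    gr D h x ^ n * gr D h y = gr D h s ^ d := by
  rw [gr_x hx hF, gr_y hF hind hd hm, gr_s hF hind hd hm, cls_pow, cls_pow, cls_mul,
    cls_congr (show n * 0 + d = d by ring) rfl, cls_congr (show d * 1 = d by ring) rfl, cls_eq_iff]
  -- With d a successor, `filtrationPred` at d unfolds to the filtration at d - 1, where the
  -- difference lies.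
  obtain ⟨d, rfl⟩ := Nat.exists_eq_add_of_le' (show 1 ≤ d by omega)
  rw [← hF, Algebra.smul_def, hx, map_pow, aeval_X] at hrel
  exact hrel

theorem gr_relation_z (h : IsLocallyNilpotent D)
    (hrel : (X : k[X]) ^ e • z - y ^ m ∈ digitSpan k[X] d m y z s (m * d - 1)) :
    gr D h x ^ e * gr D h z = gr D h y ^ m := by
  rw [gr_x hx hF, gr_z hF hind hd hm, gr_y hF hind hd hm, cls_pow, cls_pow, cls_mul,
    cls_congr (show e * 0 + m * d = m * d by ring) rfl, cls_eq_iff]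
  have hmd : 1 ≤ m * d := Nat.mul_pos (by omega) (by omega)
  obtain ⟨r, hr⟩ := Nat.exists_eq_add_of_le' hmd
  rw [← hF, Algebra.smul_def, hx, map_pow, aeval_X] at hrel
  rw [hr] at hrel ⊢
  exact hrel

end Generators

end DigitBasis

/-! ### The presented ring and its isomorphism with Gr -/

section Presentation

open Polynomial

variable (k : Type*) [Field k] (n e d m : ℕ)

/-- The ring `k[X, Y, Z, S] / ⟨X^n Y - S^d, X^e Z - Y^m⟩`; the variables `X, Y, Z, S` are numbered
`0, 1, 2, 3`. -/
abbrev GrPresentation : Type _ :=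
  MvPolynomial (Fin 4) k ⧸ Ideal.span
    {(MvPolynomial.X 0 ^ n * MvPolynomial.X 1 - MvPolynomial.X 3 ^ d : MvPolynomial (Fin 4) k),
      MvPolynomial.X 0 ^ e * MvPolynomial.X 2 - MvPolynomial.X 1 ^ m}

/-- The class of a variable in `GrPresentation`. -/
def presVar (i : Fin 4) : GrPresentation k n e d m :=
  Ideal.Quotient.mk _ (MvPolynomial.X i)

instance : Algebra k[X] (GrPresentation k n e d m) :=
  (aeval (presVar k n e d m 0)).toRingHom.toAlgebra

variable {k n e d m}

theorem algebraMap_GrPresentation_apply (p : k[X]) :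
    algebraMap k[X] (GrPresentation k n e d m) p = aeval (presVar k n e d m 0) p := rfl

theorem presVar_relation_y :
    presVar k n e d m 0 ^ n * presVar k n e d m 1 = presVar k n e d m 3 ^ d := by
  simp only [presVar, ← map_pow, ← map_mul]
  exact Ideal.Quotient.eq.2 (Ideal.subset_span (by simp))

theorem presVar_relation_z :
    presVar k n e d m 0 ^ e * presVar k n e d m 2 = presVar k n e d m 1 ^ m := by
  simp only [presVar, ← map_pow, ← map_mul]
  exact Ideal.Quotient.eq.2 (Ideal.subset_span (by simp))

theorem X_pow_smul_presentation (i : ℕ) (a : GrPresentation k n e d m) :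
    (X : k[X]) ^ i • a = presVar k n e d m 0 ^ i * a := by
  rw [Algebra.smul_def, algebraMap_GrPresentation_apply, map_pow, aeval_X]

theorem zero_smul_presentation (a : GrPresentation k n e d m) : (0 : k[X]) • a = 0 := by
  rw [Algebra.smul_def, map_zero, zero_mul]

theorem adjoin_presentation : Algebra.adjoin k[X]
    {presVar k n e d m 1, presVar k n e d m 2, presVar k n e d m 3} = ⊤ := by
  rw [eq_top_iff]
  rintro a -
  obtain ⟨f, rfl⟩ := Ideal.Quotient.mk_surjective a
  induction f using MvPolynomial.induction_on with
  | C c =>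
    have : Ideal.Quotient.mk _ (MvPolynomial.C c)
        = algebraMap k[X] (GrPresentation k n e d m) (C c) := by
      rw [algebraMap_GrPresentation_apply, aeval_C]
      rfl
    rw [this]
    exact Subalgebra.algebraMap_mem _ _
  | add p q hp hq => rw [map_add]; exact add_mem hp hq
  | mul_X p i hp =>
    rw [map_mul]
    refine mul_mem hp ?_
    change presVar k n e d m i ∈ _
    fin_cases i
    · have : presVar k n e d m 0 = algebraMap k[X] _ X := by
        rw [algebraMap_GrPresentation_apply, aeval_X]
      exact this ▸ Subalgebra.algebraMap_mem _ _
    · exact Algebra.subset_adjoin (by simp)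
    · exact Algebra.subset_adjoin (by simp)
    · exact Algebra.subset_adjoin (by simp)

theorem exists_mem_digitSpan_presentation (hd : 2 ≤ d) (hm : 2 ≤ m)
    (a : GrPresentation k n e d m) : ∃ N, a ∈ digitSpan k[X] d m
      (presVar k n e d m 1) (presVar k n e d m 2) (presVar k n e d m 3) N := by
  -- The defining relations are those of R with P and Q replaced by their leading terms and the term
  -- s dropped, hence r = 0.
  refine exists_mem_digitSpan (n := n) (e := e) (t := X) (r := 0) (P := X ^ d) (Q := X ^ m) hd hm
    (monic_X_pow d) (natDegree_X_pow d) (monic_X_pow m) (natDegree_X_pow m) ?_ ?_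
    adjoin_presentation a
  · rw [aeval_X_pow, X_pow_smul_presentation, presVar_relation_y]
  · rw [aeval_X_pow, X_pow_smul_presentation, presVar_relation_z, zero_smul_presentation, add_zero]

section Map

variable {A : Type*} [CommRing A] [Algebra k A] {x y z s : A}

/-- The map from `k[X, Y, Z, S] / ⟨X^n Y - S^d, X^e Z - Y^m⟩` given by a solution of the two
equations. -/
def presentationMap (h1 : x ^ n * y = s ^ d) (h2 : x ^ e * z = y ^ m) :
    GrPresentation k n e d m →ₐ[k] A :=
  Ideal.Quotient.liftₐ _ (MvPolynomial.aeval ![x, y, z, s]) fun a ha => by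
    have hle : Ideal.span
        {(MvPolynomial.X 0 ^ n * MvPolynomial.X 1 - MvPolynomial.X 3 ^ d : MvPolynomial (Fin 4) k),
          MvPolynomial.X 0 ^ e * MvPolynomial.X 2 - MvPolynomial.X 1 ^ m}
        ≤ RingHom.ker (MvPolynomial.aeval ![x, y, z, s] : MvPolynomial (Fin 4) k →ₐ[k] A) := by
      rw [Ideal.span_le]
      rintro f (rfl | rfl)
      · simp [RingHom.mem_ker, h1]
      · simp [RingHom.mem_ker, h2]
    exact hle ha

variable (h1 : x ^ n * y = s ^ d) (h2 : x ^ e * z = y ^ m)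

theorem presentationMap_presVar (i : Fin 4) :
    presentationMap (k := k) h1 h2 (presVar k n e d m i) = ![x, y, z, s] i :=
  MvPolynomial.aeval_X _ _

theorem presentationMap_smul_digitMonomial (c : k[X]) (N : ℕ) :
    presentationMap (k := k) h1 h2 (c • digitMonomial d m (presVar k n e d m 1)
      (presVar k n e d m 2) (presVar k n e d m 3) N) = aeval x c * digitMonomial d m y z s N := by
  rw [Algebra.smul_def, algebraMap_GrPresentation_apply, map_mul, ← aeval_algHom_apply,
    digitMonomial]
  simp only [map_mul, map_pow, presentationMap_presVar]
  rfl

theorem presentationMap_surjective (hgen : Algebra.adjoin k {x, y, z, s} = ⊤) :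
    Function.Surjective (presentationMap (k := k) h1 h2) := by
  rw [← AlgHom.range_eq_top, eq_top_iff, ← hgen, Algebra.adjoin_le_iff]
  rintro u (rfl | rfl | rfl | rfl)
  · exact ⟨_, presentationMap_presVar h1 h2 0⟩
  · exact ⟨_, presentationMap_presVar h1 h2 1⟩
  · exact ⟨_, presentationMap_presVar h1 h2 2⟩
  · exact ⟨_, presentationMap_presVar h1 h2 3⟩

end Map

variable {B : Type*} [CommRing B] [Algebra k B] [Algebra k[X] B]
  {D : Derivation k B B} {x y z s : B}

/-- Distinct digit monomials go to distinct homogeneous components, and in each component a nonzero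
coefficient stays nonzero by `hind`. Linear independence in the presented ring is not needed
beforehand; spanning is enough. -/
theorem presentationMap_injective
    (hx : ∀ p : k[X], algebraMap k[X] B p = aeval x p)
    (hF : ∀ N a, a ∈ filtration D N ↔ a ∈ digitSpan k[X] d m y z s N)
    (hind : ∀ N (c : k[X]), c • digitMonomial d m y z s N ∈ filtrationPred D N → c = 0)
    (hd : 2 ≤ d) (hm : 2 ≤ m) (h : IsLocallyNilpotent D)
    (h1 : gr D h x ^ n * gr D h y = gr D h s ^ d) (h2 : gr D h x ^ e * gr D h z = gr D h y ^ m) :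
    Function.Injective (presentationMap (k := k) h1 h2) := by
  set ψ := presentationMap (k := k) h1 h2 with hψ
  set b : ℕ → GrPresentation k n e d m := digitMonomial d m (presVar k n e d m 1)
    (presVar k n e d m 2) (presVar k n e d m 3) with hb
  have hψb (c : k[X]) (N : ℕ) : ψ (c • b N)
      = cls D N (c • digitMonomial d m y z s N) (smul_digitMonomial_mem_filtration hF N c) := by
    rw [hψ, hb, presentationMap_smul_digitMonomial, aeval_gr_mul_digitMonomial hx hF hind hd hm]
  have hcoeff (c : k[X]) (N : ℕ) (hc : ψ (c • b N) N = 0) : c = 0 := by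
    rw [hψb] at hc
    exact hind N c (mem_filtrationPred_of_cls_apply hc)
  -- The vanishing of components above N is carried along so that component N + 1 of the image
  -- isolates the top coefficient.
  have key (N : ℕ) : ∀ u ∈ digitSpan k[X] d m (presVar k n e d m 1)
      (presVar k n e d m 2) (presVar k n e d m 3) N,
      (∀ M, N < M → ψ u M = 0) ∧ (ψ u = 0 → u = 0) := by
    induction N with
    | zero =>
      intro u hu
      obtain ⟨c, rfl⟩ := mem_digitSpan_zero.1 hu
      have h0 : (1 : GrPresentation k n e d m) = b 0 := by simp [hb, digitMonomial]
      rw [h0]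
      refine ⟨fun M hM => ?_, fun hc => ?_⟩
      · rw [hψb]
        exact cls_apply_of_ne hM.ne
      · rw [hcoeff c 0 (by rw [hc]; rfl), zero_smul_presentation]
    | succ N ih =>
      intro u hu
      obtain ⟨c, v, hv, rfl⟩ := mem_digitSpan_succ.1 hu
      obtain ⟨ih1, ih2⟩ := ih v hv
      change (∀ M, N + 1 < M → ψ (c • b (N + 1) + v) M = 0)
        ∧ (ψ (c • b (N + 1) + v) = 0 → c • b (N + 1) + v = 0)
      refine ⟨fun M hM => ?_, fun hc => ?_⟩
      · rw [map_add, DirectSum.add_apply, ih1 M (by omega), hψb, cls_apply_of_ne hM.ne, add_zero]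
      · have hN : ψ (c • b (N + 1) + v) (N + 1) = 0 := by rw [hc]; rfl
        rw [map_add, DirectSum.add_apply, ih1 _ N.lt_succ_self, add_zero] at hN
        obtain rfl := hcoeff c _ hN
        rw [zero_smul_presentation, zero_add] at hc ⊢
        exact ih2 hc
  refine (injective_iff_map_eq_zero ψ).2 fun u hu => ?_
  obtain ⟨N, hN⟩ := exists_mem_digitSpan_presentation hd hm u
  exact (key N u hN).2 hu

end Presentation

end LND

end

/-! ### The theorem -/

theorem theorem4 {k : Type*} [Field k] [CharZero k] (n e d m : ℕ)
    (hn : 1 ≤ n) (hne : (n, e) ≠ (1, 0)) (hd : 2 ≤ d) (hm : 2 ≤ m)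
    (P Q : Polynomial (Polynomial k))
    (hP : P.Monic) (hPd : P.natDegree = d) (hQ : Q.Monic) (hQm : Q.natDegree = m)
    (D : Derivation k (LND.R n e P Q) (LND.R n e P Q)) (hD : D = LND.del n e P Q)
    (x y z s : LND.R n e P Q)
    (hx : x = LND.proj n e P Q (MvPolynomial.X 0))
    (hy : y = LND.proj n e P Q (MvPolynomial.X 1))
    (hz : z = LND.proj n e P Q (MvPolynomial.X 2))
    (hs : s = LND.bieval x y Q - x ^ e * z) :
    ∃ h : LND.IsLocallyNilpotent D,
      (∀ i j l : ℕ, j < m → l < d →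
        LND.filtration D (m * d * i + d * j + l) =
          LND.polyMul k x (s ^ l * y ^ j * z ^ i) ⊔
            LND.filtrationPred D (m * d * i + d * j + l)) ∧
      Algebra.adjoin k {LND.gr D h x, LND.gr D h y, LND.gr D h z, LND.gr D h s} = ⊤ ∧
      LND.gr D h x ^ n * LND.gr D h y = LND.gr D h s ^ d ∧
      LND.gr D h x ^ e * LND.gr D h z = LND.gr D h y ^ m ∧
      (∃ Φ : (MvPolynomial (Fin 4) k ⧸ Ideal.span
            {(MvPolynomial.X 0 ^ n * MvPolynomial.X 1 - MvPolynomial.X 3 ^ d :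
                MvPolynomial (Fin 4) k),
              MvPolynomial.X 0 ^ e * MvPolynomial.X 2 - MvPolynomial.X 1 ^ m}) ≃ₐ[k] LND.Gr D,
        Φ (Ideal.Quotient.mk _ (MvPolynomial.X 0)) = LND.gr D h x ∧
        Φ (Ideal.Quotient.mk _ (MvPolynomial.X 1)) = LND.gr D h y ∧
        Φ (Ideal.Quotient.mk _ (MvPolynomial.X 2)) = LND.gr D h z ∧
        Φ (Ideal.Quotient.mk _ (MvPolynomial.X 3)) = LND.gr D h s) ∧
      (∀ i j l : ℕ, j < m → l < d →
        LND.homogeneousPiece D (m * d * i + d * j + l) =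
          LND.polyMul k (LND.gr D h x)
            (LND.gr D h s ^ l * LND.gr D h y ^ j * LND.gr D h z ^ i)) := by
  have hs' : s = LND.proj n e P Q (LND.sPoly e Q) := by
    rw [hs, hx, hy, hz, LND.proj_sPoly]
  have halg (p : Polynomial k) :
      algebraMap (Polynomial k) (LND.R n e P Q) p = Polynomial.aeval x p := by
    rw [hx, LND.algebraMap_R_apply]
  have hF (N : ℕ) (a : LND.R n e P Q) :
      a ∈ LND.filtration D N ↔ a ∈ LND.digitSpan (Polynomial k) d m y z s N := by
    rw [hD, hy, hz, hs', LND.mem_filtration_iff hd hm hP hPd hQ hQm]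
  have hind (N : ℕ) (c : Polynomial k)
      (hc : c • LND.digitMonomial d m y z s N ∈ LND.filtrationPred D N) : c = 0 := by
    rw [hD, hy, hz, hs'] at hc
    exact LND.eq_zero_of_smul_mem_filtrationPred hd hm hP hPd hQ hQm N c hc
  have hPs : Polynomial.aeval s P = (Polynomial.X : Polynomial k) ^ n • y := by
    rw [hs', hy, LND.aeval_sPoly]
  have hQy : Polynomial.aeval y Q
      = (Polynomial.X : Polynomial k) ^ e • z + (1 : Polynomial k) • s := by
    rw [hs', hy, hz, LND.aeval_y]
  -- Every element lies in some digit span, which is a member F_N of the filtration, so the power N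
  -- + 1 kills it.
  have h : LND.IsLocallyNilpotent D := fun a => by
    obtain ⟨N, hN⟩ := LND.exists_mem_digitSpan_R hd hm hP hPd hQ hQm a
    rw [← hy, ← hz, ← hs', ← hF] at hN
    exact ⟨N + 1, hN⟩
  have h1 := LND.gr_relation_y halg hF hind hd hm h
    (LND.smul_sub_pow_mem_digitSpan hd hm hP hPd hQ hQm hPs hQy)
  have h2 := LND.gr_relation_z halg hF hind hd hm h
    (LND.smul_sub_pow_mem_digitSpan' hd hm hP hPd hQ hQm hPs hQy)
  have hgen := LND.adjoin_gr halg hF hind hd hm h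
  refine ⟨h, fun i j l hj hl => ?_, hgen, h1, h2, ⟨AlgEquiv.ofBijective
    (LND.presentationMap h1 h2) ⟨LND.presentationMap_injective halg hF hind hd hm h h1 h2,
      LND.presentationMap_surjective h1 h2 hgen⟩, ?_, ?_, ?_, ?_⟩, fun i j l hj hl => ?_⟩
  · rw [LND.filtration_eq_polyMul_sup halg hF, LND.digitMonomial_eq _ _ _ hj hl]
  · exact LND.presentationMap_presVar h1 h2 0
  · exact LND.presentationMap_presVar h1 h2 1
  · exact LND.presentationMap_presVar h1 h2 2
  · exact LND.presentationMap_presVar h1 h2 3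
  · rw [LND.homogeneousPiece_eq_polyMul halg hF hind hd hm h, LND.digitMonomial_eq _ _ _ hj hl]
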